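/- Let $X$ be an $n$-dimensional real or complex inner product space (the inner product conjugate-linear in its first argument), and let $\bigwedge X$ be its exterior algebra with the inner product for which $\langle v_1\wedge\dots\wedge v_p, w_1\wedge\dots\wedge w_p\rangle=\det(\langle v_i,w_j\rangle)$, $\langle\lambda,\mu\rangle=\overline{\lambda}\mu$ for scalars, and elements of distinct grades are orthogonal. Fix an orientation, i.e. an element $\Omega\in\bigwedge^n X$ with $\|\Omega\|=1$. For $M\in\bigwedge X$ let the dual $M^\star\in\bigwedge X$ be the unique element with $\langle L, M^\star\rangle=\langle M\wedge L,\Omega\rangle$ for all $L\in\bigwedge X$; the map $M\mapsto M^\star$ is bijective, and the regressive product $M\vee N$ is defined by $(M\vee N)^\star=M^\star\wedge N^\star$. A blade is a scalar or a product $v_1\wedge\dots\wedge v_p$ of vectors of $X$. Its space is $[B]=\operatorname{span}(v_1,\dots,v_p)$ if $0\neq B=v_1\wedge\dots\wedge v_p$, and $[B]=\{0\}$ if $B$ is a scalar (including $B=0$). For subspaces $V,W\subset X$ of dimensions $p,q$, with $m=\min\{p,q\}$, associated principal bases are orthonormal bases $(e_1,\dots,e_p)$ of $V$ and $(f_1,\dots,f_q)$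 of $W$ such that $\langle e_i,f_j\rangle=0$ for $i\neq j$ and $\langle e_i,f_i\rangle=\cos\theta_i$ for $1\le i\le m$, with $0\le\theta_1\le\dots\le\theta_m\le\frac{\pi}{2}$. The asymmetric angle of $V$ with $W$ is $$\Theta_{V,W}=\cos^{-1}\frac{|\langle C,D_P\rangle|}{\|C\|\,\|D\|}\in\left[0,\tfrac{\pi}{2}\right],$$ where $C,D$ are nonzero blades with $[C]=V$ and $[D]=W$, and $D=D_P\wedge D_\perp$ with $D_P=\epsilon\|D\|\,f_1\wedge\dots\wedge f_m$, $D_\perp=f_{m+1}\wedge\dots\wedge f_q$, $|\epsilon|=1$, for associated principal bases as above (empty products are $1$); it does not depend on the choices. Then, for all blades $A,B\in\bigwedge X$, $$\|A\vee B\|=\|A\|\,\|B\|\,\cos\Theta_{[A]^\perp,[B]}.$$ -/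

import Mathlib

noncomputable section

namespace Grassmann

open ExteriorAlgebra

variable {𝕜 : Type*} [RCLike 𝕜] {X : Type*} [NormedAddCommGroup X] [InnerProductSpace 𝕜 X]

/-- For fixed `v₁, …, v_p`, the alternating map `(w₁, …, w_k) ↦ det ⟪v_i, w_j⟫` if `k = p`, and `0` if
`k ≠ p`. -/
def gramAlternating {p : ℕ} (v : Fin p → X) (k : ℕ) : X [⋀^Fin k]→ₗ[𝕜] 𝕜 :=
  if h : k = p then
    Matrix.detRowAlternating.compLinearMap
      (LinearMap.pi fun i : Fin k => innerₛₗ 𝕜 (v (Fin.cast h i)))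
  else 0

/-- The linear functional `N ↦ ⟪v₁ ∧ ⋯ ∧ v_p, N⟫` on the exterior algebra. -/
def gramFunctional {p : ℕ} (v : Fin p → X) : ExteriorAlgebra 𝕜 X →ₗ[𝕜] 𝕜 :=
  liftAlternating (gramAlternating v)

theorem gramFunctional_ιMulti_same {p : ℕ} (v w : Fin p → X) :
    gramFunctional v (ιMulti 𝕜 p w) = Matrix.det (Matrix.of fun i j => inner 𝕜 (v i) (w j)) := by
  rw [gramFunctional, liftAlternating_apply_ιMulti, gramAlternating, dif_pos rfl,
    ← Matrix.det_transpose]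
  rfl

theorem gramFunctional_ιMulti_ne {p q : ℕ} (h : p ≠ q) (v : Fin p → X) (w : Fin q → X) :
    gramFunctional v (ιMulti 𝕜 q w) = 0 := by
  rw [gramFunctional, liftAlternating_apply_ιMulti, gramAlternating, dif_neg (Ne.symm h)]
  rfl

theorem gram_update {p : ℕ} (v w : Fin p → X) (i : Fin p) (x : X) :
    (Matrix.of fun a b => inner 𝕜 (Function.update v i x a) (w b)) =
      (Matrix.of fun a b => inner 𝕜 (v a) (w b)).updateRow i (fun b => inner 𝕜 x (w b)) := by
  ext a b
  by_cases h : a = i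
  · subst h; simp
  · simp [h]

/-- The map `(w₁, …, w_p) ↦ (M ↦ ⟪M, w₁ ∧ ⋯ ∧ w_p⟫)`, which is alternating in the `w_i` and
conjugate-linear in `M`. -/
def conjGram (p : ℕ) :
    X [⋀^Fin p]→ₗ[𝕜] (ExteriorAlgebra 𝕜 X →ₛₗ[starRingEnd 𝕜] 𝕜) :=
  { toFun := fun v => (starLinearEquiv 𝕜 : 𝕜 ≃ₗ⋆[𝕜] 𝕜).toLinearMap.comp (gramFunctional v)
    map_update_add' := by
      intro inst v i x y
      obtain rfl : inst = instDecidableEqFin p := Subsingleton.elim _ _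
      have h : gramFunctional (𝕜 := 𝕜) (Function.update v i (x + y)) =
          gramFunctional (Function.update v i x) + gramFunctional (Function.update v i y) := by
        ext q w
        simp only [LinearMap.compAlternatingMap_apply, LinearMap.add_apply]
        by_cases hq : p = q
        · subst hq
          simp only [gramFunctional_ιMulti_same]
          rw [gram_update, gram_update, gram_update, ← Matrix.det_updateRow_add]
          congr 2
          ext b
          simp [inner_add_left]
        · simp [gramFunctional_ιMulti_ne hq]
      ext N
      simp [h]
    map_update_smul' := by
      intro inst v i c x
      obtain rfl : inst = instDecidableEqFin p := Subsingleton.elim _ _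
      have h : gramFunctional (𝕜 := 𝕜) (Function.update v i (c • x)) =
          star c • gramFunctional (Function.update v i x) := by
        ext q w
        simp only [LinearMap.compAlternatingMap_apply, LinearMap.smul_apply]
        by_cases hq : p = q
        · subst hq
          simp only [gramFunctional_ιMulti_same]
          rw [gram_update, gram_update, smul_eq_mul, ← Matrix.det_updateRow_smul]
          congr 2
          ext b
          simp [inner_smul_left]
        · simp [gramFunctional_ιMulti_ne hq]
      ext N
      simp [h]
    map_eq_zero_of_eq' := by
      intro v i j hv hij
      have h : gramFunctional (𝕜 := 𝕜) v = 0 := by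
        ext q w
        simp only [LinearMap.compAlternatingMap_apply, LinearMap.zero_apply]
        by_cases hq : p = q
        · subst hq
          simp only [gramFunctional_ιMulti_same]
          exact Matrix.det_zero_of_row_eq hij (by ext b; simp [hv])
        · simp [gramFunctional_ιMulti_ne hq]
      ext N
      simp [h] }

/-- The inner product of the exterior algebra with its arguments swapped: `innerForm N M = ⟪M, N⟫`. -/
def innerForm : ExteriorAlgebra 𝕜 X →ₗ[𝕜] (ExteriorAlgebra 𝕜 X →ₛₗ[starRingEnd 𝕜] 𝕜) :=
  liftAlternating conjGram

theorem innerForm_same {p : ℕ} (v w : Fin p → X) :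
    innerForm (ιMulti 𝕜 p w) (ιMulti 𝕜 p v) =
      Matrix.det (Matrix.of fun i j => inner 𝕜 (v i) (w j)) := by
  rw [innerForm, liftAlternating_apply_ιMulti]
  change star (gramFunctional w (ιMulti 𝕜 p v)) = _
  rw [gramFunctional_ιMulti_same, ← Matrix.det_conjTranspose]
  congr 1
  ext i j
  simp [Matrix.conjTranspose_apply]

theorem innerForm_ne {p q : ℕ} (h : p ≠ q) (v : Fin p → X) (w : Fin q → X) :
    innerForm (ιMulti 𝕜 q w) (ιMulti 𝕜 p v) = 0 := by
  rw [innerForm, liftAlternating_apply_ιMulti]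
  change star (gramFunctional w (ιMulti 𝕜 p v)) = _
  rw [gramFunctional_ιMulti_ne h.symm, star_zero]

theorem innerForm_basis {I : Type*} [Fintype I] [LinearOrder I] (b : OrthonormalBasis I 𝕜 X)
    (s t : Finset I) :
    innerForm (b.toBasis.ExteriorAlgebra t) (b.toBasis.ExteriorAlgebra s) =
      if s = t then (1 : 𝕜) else 0 := by
  by_cases hc : s.card = t.card
  · rw [ExteriorAlgebra.basis_apply_ofCard b.toBasis (rfl : s.card = s.card),
      ExteriorAlgebra.basis_apply_ofCard b.toBasis hc.symm, innerForm_same]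
    split_ifs with h
    · subst h
      rw [← Matrix.det_one (n := Fin s.card)]
      congr 1
      ext i j
      simp [Matrix.one_apply, orthonormal_iff_ite.mp b.orthonormal]
    · have h' : Set.powersetCard.ofCard (rfl : s.card = s.card) ≠
          Set.powersetCard.ofCard hc.symm := fun e => h (congrArg Subtype.val e)
      obtain ⟨x, hxs, hxt⟩ := (Set.powersetCard.exists_mem_notMem_iff_ne _ _).mp h'
      simp only [Set.mem_range, not_exists,
        ← Set.powersetCard.mem_range_ofFinEmbEquiv_symm_iff_mem] at hxs hxt
      obtain ⟨i, rfl⟩ := hxs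
      refine Matrix.det_eq_zero_of_row_eq_zero i fun j => ?_
      simpa using b.orthonormal.inner_eq_zero fun e => hxt j e.symm
  · rw [ExteriorAlgebra.basis_apply, ExteriorAlgebra.basis_apply, innerForm_ne hc,
      if_neg fun e => hc (by rw [e])]

theorem innerForm_eq_sum {I : Type*} [Fintype I] [LinearOrder I] (b : OrthonormalBasis I 𝕜 X)
    (M N : ExteriorAlgebra 𝕜 X) :
    innerForm N M = ∑ s, b.toBasis.ExteriorAlgebra.repr N s *
      star (b.toBasis.ExteriorAlgebra.repr M s) := by
  conv_lhs =>
    rw [← b.toBasis.ExteriorAlgebra.sum_repr M, ← b.toBasis.ExteriorAlgebra.sum_repr N]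
  simp only [map_sum, LinearMap.sum_apply, map_smul, LinearMap.smul_apply, LinearMap.map_smulₛₗ,
    innerForm_basis]
  simp [mul_comm]

instance [FiniteDimensional 𝕜 X] : FiniteDimensional 𝕜 (ExteriorAlgebra 𝕜 X) :=
  Module.Basis.finiteDimensional_of_finite
    (stdOrthonormalBasis 𝕜 X).toBasis.ExteriorAlgebra

variable (𝕜 X) in
/-- The inner product of the exterior algebra: conjugate-linear in the first argument, given by the
Gram determinant on blades of equal grade, and with blades of distinct grades orthogonal. -/
abbrev innerCore [FiniteDimensional 𝕜 X] :
    InnerProductSpace.Core 𝕜 (ExteriorAlgebra 𝕜 X) where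
  inner M N := innerForm N M
  conj_inner_symm M N := by
    simp only [innerForm_eq_sum (stdOrthonormalBasis 𝕜 X), map_sum, map_mul]
    exact Finset.sum_congr rfl fun s _ => by simp [mul_comm]
  add_left M M' N := by simp
  smul_left M N c := by simp
  re_inner_nonneg M := by
    rw [innerForm_eq_sum (stdOrthonormalBasis 𝕜 X), map_sum]
    refine Finset.sum_nonneg fun s _ => ?_
    rw [RCLike.star_def, RCLike.mul_conj]
    norm_cast
    positivity
  definite M h := by
    rw [innerForm_eq_sum (stdOrthonormalBasis 𝕜 X)] at h
    simp only [RCLike.star_def, RCLike.mul_conj] at h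
    norm_cast at h
    rw [Finset.sum_eq_zero_iff_of_nonneg (fun _ _ => by positivity)] at h
    apply (stdOrthonormalBasis 𝕜 X).toBasis.ExteriorAlgebra.ext_elem
    intro s
    simpa using h s (Finset.mem_univ s)

instance [FiniteDimensional 𝕜 X] : NormedAddCommGroup (ExteriorAlgebra 𝕜 X) :=
  (innerCore 𝕜 X).toNormedAddCommGroup

instance [FiniteDimensional 𝕜 X] : InnerProductSpace 𝕜 (ExteriorAlgebra 𝕜 X) :=
  InnerProductSpace.ofCore (innerCore 𝕜 X).toCore

variable [FiniteDimensional 𝕜 X]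

theorem inner_ιMulti {p : ℕ} (v w : Fin p → X) :
    inner 𝕜 (ιMulti 𝕜 p v) (ιMulti 𝕜 p w) =
      Matrix.det (Matrix.of fun i j => inner 𝕜 (v i) (w j)) :=
  innerForm_same v w

/-- The left contraction `M ⌟ N`, characterized by `⟪L, M ⌟ N⟫ = ⟪M ∧ L, N⟫` for all `L`. -/
def leftContraction (M N : ExteriorAlgebra 𝕜 X) : ExteriorAlgebra 𝕜 X :=
  LinearMap.adjoint (LinearMap.mulLeft 𝕜 M) N

theorem inner_leftContraction (L M N : ExteriorAlgebra 𝕜 X) :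
    inner 𝕜 L (leftContraction M N) = inner 𝕜 (M * L) N := by
  rw [leftContraction, LinearMap.adjoint_inner_right, LinearMap.mulLeft_apply]


theorem leftContraction_eq_iff (M N K : ExteriorAlgebra 𝕜 X) :
    leftContraction M N = K ↔ ∀ L, inner 𝕜 L K = inner 𝕜 (M * L) N := by
  refine ⟨fun h L => by rw [← h, inner_leftContraction], fun h => ?_⟩
  exact ext_inner_left 𝕜 fun L => by rw [inner_leftContraction, h]

/-- An orientation element: a unit `n`-vector, where `n = dim X`. -/
structure IsOrientation (Ω : ExteriorAlgebra 𝕜 X) : Prop where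
  mem : Ω ∈ ⋀[𝕜]^(Module.finrank 𝕜 X) X
  norm_eq_one : ‖Ω‖ = 1

/-- The right star (right dual) `M^⋆ = M ⌟ Ω`. -/
def rightStar (Ω M : ExteriorAlgebra 𝕜 X) : ExteriorAlgebra 𝕜 X :=
  leftContraction M Ω

theorem inner_basis_orientation {Ω : ExteriorAlgebra 𝕜 X} (hΩ : IsOrientation Ω)
    (s : Finset (Fin (Module.finrank 𝕜 X))) (hs : s ≠ Finset.univ) :
    inner 𝕜 ((stdOrthonormalBasis 𝕜 X).toBasis.ExteriorAlgebra s) Ω = 0 := by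
  have hc : s.card ≠ Module.finrank 𝕜 X := fun h =>
    hs ((Finset.card_eq_iff_eq_univ s).mp (by simpa using h))
  have h := hΩ.mem
  clear hΩ
  rw [← ExteriorAlgebra.ιMulti_span_fixedDegree] at h
  induction h using Submodule.span_induction with
  | mem x hx =>
    obtain ⟨w, rfl⟩ := hx
    rw [ExteriorAlgebra.basis_apply]
    exact innerForm_ne hc _ w
  | zero => simp
  | add x y _ _ hx hy => rw [inner_add_right, hx, hy, add_zero]
  | smul c x _ hx => rw [inner_smul_right, hx, mul_zero]

theorem inner_basis_univ_orientation {Ω : ExteriorAlgebra 𝕜 X} (hΩ : IsOrientation Ω) :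
    inner 𝕜 ((stdOrthonormalBasis 𝕜 X).toBasis.ExteriorAlgebra Finset.univ) Ω ≠ 0 := by
  intro h
  have h0 : Ω = 0 := by
    refine InnerProductSpace.ext_inner_left_basis (𝕜 := 𝕜)
      (stdOrthonormalBasis 𝕜 X).toBasis.ExteriorAlgebra fun s => ?_
    rw [inner_zero_right]
    by_cases hs : s = Finset.univ
    · rw [hs, h]
    · exact inner_basis_orientation hΩ s hs
  simpa [h0] using hΩ.norm_eq_one

theorem basis_mul_disjoint {I : Type*} [LinearOrder I] (b : Module.Basis I 𝕜 X)
    (s t : Finset I) (h : Disjoint s t) :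
    b.ExteriorAlgebra s * b.ExteriorAlgebra t = b.ExteriorAlgebra (s.disjUnion t h) ∨
      b.ExteriorAlgebra s * b.ExteriorAlgebra t = -b.ExteriorAlgebra (s.disjUnion t h) := by
  have h1 := ExteriorAlgebra.basis_mul_of_disjoint b (Set.powersetCard.ofCard (s := s) rfl)
    (Set.powersetCard.ofCard (s := t) rfl) h
  rcases Int.units_eq_one_or (Equiv.Perm.sign (Set.powersetCard.permOfDisjoint
    (s := Set.powersetCard.ofCard (s := s) rfl)
    (t := Set.powersetCard.ofCard (s := t) rfl) h)) with hσ | hσ <;> rw [hσ] at h1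
  · exact Or.inl (h1.trans (one_smul _ _))
  · exact Or.inr (h1.trans (by
      rw [Units.smul_def, Units.val_neg, Units.val_one, neg_smul, one_smul]
      rfl))

theorem eq_zero_of_inner_mul_orientation {Ω : ExteriorAlgebra 𝕜 X} (hΩ : IsOrientation Ω)
    (M : ExteriorAlgebra 𝕜 X) (h : ∀ L, inner 𝕜 Ω (M * L) = 0) : M = 0 := by
  set b := (stdOrthonormalBasis 𝕜 X).toBasis with hb
  refine b.ExteriorAlgebra.ext_elem fun s => ?_
  have key : ∀ t, t ≠ s → inner 𝕜 Ω (b.ExteriorAlgebra t * b.ExteriorAlgebra sᶜ) = 0 := by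
    intro t hts
    by_cases hd : Disjoint t sᶜ
    · have hne : t.disjUnion sᶜ hd ≠ Finset.univ := by
        intro e
        apply hts
        have h1 : t ⊆ s := disjoint_compl_right_iff.mp hd
        refine Finset.Subset.antisymm h1 fun x hx => ?_
        have := Finset.mem_univ x
        rw [← e, Finset.mem_disjUnion] at this
        simpa [hx] using this
      have hu : inner 𝕜 Ω (b.ExteriorAlgebra (t.disjUnion sᶜ hd)) = 0 := by
        rw [← inner_conj_symm, inner_basis_orientation hΩ _ hne, map_zero]
      rcases basis_mul_disjoint b t sᶜ hd with h1 | h1 <;> rw [h1]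
      · exact hu
      · rw [inner_neg_right, hu, neg_zero]
    · have := ExteriorAlgebra.basis_mul_of_not_disjoint b (Set.powersetCard.ofCard (s := t) rfl)
        (Set.powersetCard.ofCard (s := sᶜ) rfl) hd
      simp only [Set.powersetCard.val_ofCard] at this
      rw [this, inner_zero_right]
  have key' : inner 𝕜 Ω (b.ExteriorAlgebra s * b.ExteriorAlgebra sᶜ) ≠ 0 := by
    have hd : Disjoint s sᶜ := disjoint_compl_right
    have hu : inner 𝕜 Ω (b.ExteriorAlgebra (s.disjUnion sᶜ hd)) ≠ 0 := by
      rw [Finset.disjUnion_eq_union, Finset.union_compl, Ne, inner_eq_zero_symm]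
      exact inner_basis_univ_orientation hΩ
    rcases basis_mul_disjoint b s sᶜ hd with h1 | h1 <;> rw [h1] <;> simpa using hu
  have := h (b.ExteriorAlgebra sᶜ)
  rw [← b.ExteriorAlgebra.sum_repr M, Finset.sum_mul, inner_sum,
    Finset.sum_eq_single s] at this
  · rw [smul_mul_assoc, inner_smul_right] at this
    simpa [key'] using this
  · intro t _ hts
    rw [smul_mul_assoc, inner_smul_right, key t hts, mul_zero]
  · simp

theorem rightStar_bijective {Ω : ExteriorAlgebra 𝕜 X} (hΩ : IsOrientation Ω) :
    Function.Bijective (rightStar Ω) := by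
  let Φ : ExteriorAlgebra 𝕜 X →ₗ[𝕜] Module.Dual 𝕜 (ExteriorAlgebra 𝕜 X) :=
    (LinearMap.mul 𝕜 (ExteriorAlgebra 𝕜 X)).compr₂ (innerₛₗ 𝕜 Ω)
  have hΦ : ∀ M N, rightStar Ω M = N ↔ Φ M = innerₛₗ 𝕜 N := by
    intro M N
    rw [rightStar, leftContraction_eq_iff, LinearMap.ext_iff]
    refine forall_congr' fun L => ?_
    change _ ↔ inner 𝕜 Ω (M * L) = inner 𝕜 N L
    rw [← inner_conj_symm Ω, ← inner_conj_symm N, (starRingEnd 𝕜).injective.eq_iff, eq_comm]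
  have hinj : Function.Injective Φ := by
    rw [injective_iff_map_eq_zero]
    exact fun M hM => eq_zero_of_inner_mul_orientation hΩ M fun L => LinearMap.congr_fun hM L
  have hsurj : Function.Surjective Φ :=
    (LinearMap.injective_iff_surjective_of_finrank_eq_finrank
      (Subspace.dual_finrank_eq (K := 𝕜) (V := ExteriorAlgebra 𝕜 X)).symm).mp hinj
  refine ⟨fun M M' h => hinj ?_, fun N => ?_⟩
  · rw [(hΦ M _).mp rfl, (hΦ M' _).mp rfl, h]
  · obtain ⟨M, hM⟩ := hsurj (innerₛₗ 𝕜 N)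
    exact ⟨M, (hΦ M N).mpr hM⟩

/-- The regressive product `M ∨ N`, given by `(M ∨ N)^⋆ = M^⋆ ∧ N^⋆`. For an orientation `Ω` the star is
bijective, see `rightStar_bijective` and `regressive_eq_iff`. -/
def regressive (Ω M N : ExteriorAlgebra 𝕜 X) : ExteriorAlgebra 𝕜 X :=
  Function.invFun (rightStar Ω) (rightStar Ω M * rightStar Ω N)

theorem regressive_eq_iff {Ω : ExteriorAlgebra 𝕜 X} (hΩ : IsOrientation Ω)
    (M N R : ExteriorAlgebra 𝕜 X) :
    regressive Ω M N = R ↔ rightStar Ω R = rightStar Ω M * rightStar Ω N := by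
  have h : rightStar Ω (regressive Ω M N) = rightStar Ω M * rightStar Ω N :=
    Function.rightInverse_invFun (rightStar_bijective hΩ).2 _
  rw [← h, (rightStar_bijective hΩ).1.eq_iff, eq_comm]

/-- Blades: the scalars, and the products `v₁ ∧ ⋯ ∧ v_p`. -/
def IsBlade (B : ExteriorAlgebra 𝕜 X) : Prop :=
  (∃ c : 𝕜, B = algebraMap 𝕜 (ExteriorAlgebra 𝕜 X) c) ∨
    ∃ (p : ℕ) (v : Fin p → X), B = ιMulti 𝕜 p v

/-- The space `[B]` of a blade: `span (v₁, …, v_p)` if `0 ≠ B = v₁ ∧ ⋯ ∧ v_p` (see `bladeSpace_ιMulti`), and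
`{0}` if `B` is a scalar, in particular if `B = 0` (see `bladeSpace_algebraMap`). All the spans in the
supremum are equal. -/
def bladeSpace (B : ExteriorAlgebra 𝕜 X) : Submodule 𝕜 X :=
  ⨆ (p : ℕ) (v : Fin p → X) (_ : B ≠ 0 ∧ B = ιMulti 𝕜 p v), Submodule.span 𝕜 (Set.range v)

theorem ιMulti_ne_zero_iff {p : ℕ} (v : Fin p → X) :
    ιMulti 𝕜 p v ≠ 0 ↔ LinearIndependent 𝕜 v := by
  refine ⟨fun h => by_contra fun h' => h ((ιMulti 𝕜 p).map_linearDependent v h'), fun h => ?_⟩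
  set s : Set.powersetCard (Fin p) p := Set.powersetCard.ofCard (s := Finset.univ) (by simp)
  have h1 := (exteriorPower.ιMulti_family_linearIndependent_field (n := p) h).ne_zero s
  have hs : ⇑(Set.powersetCard.ofFinEmbEquiv.symm s) = id := by
    refine StrictMono.range_inj (OrderEmbedding.strictMono _) strictMono_id |>.mp ?_
    ext i
    rw [Set.powersetCard.mem_range_ofFinEmbEquiv_symm_iff_mem]
    exact ⟨fun _ => ⟨i, rfl⟩, fun _ => Finset.mem_univ i⟩
  intro h0
  apply h1
  rw [exteriorPower.ιMulti_family, hs]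
  exact Subtype.ext h0

theorem span_le_of_ιMulti_eq {p q : ℕ} (v : Fin p → X) (w : Fin q → X)
    (h0 : ιMulti 𝕜 p v ≠ 0) (h : ιMulti 𝕜 p v = ιMulti 𝕜 q w) :
    Submodule.span 𝕜 (Set.range w) ≤ Submodule.span 𝕜 (Set.range v) := by
  rw [Submodule.span_le]
  rintro _ ⟨j, rfl⟩
  by_contra hj
  have h1 : LinearIndependent 𝕜 (Fin.cons (w j) v : Fin (p + 1) → X) :=
    LinearIndependent.finCons ((ιMulti_ne_zero_iff v).mp h0) hj
  apply (ιMulti_ne_zero_iff _).mpr h1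
  rw [ιMulti_succ_apply]
  change ι 𝕜 (w j) * ιMulti 𝕜 p v = 0
  rw [h, ιMulti_apply]
  exact ι_mul_prod_list w j

theorem bladeSpace_ιMulti {p : ℕ} (v : Fin p → X) (h0 : ιMulti 𝕜 p v ≠ 0) :
    bladeSpace (ιMulti 𝕜 p v) = Submodule.span 𝕜 (Set.range v) := by
  refine le_antisymm ?_ ?_
  · simp only [bladeSpace, iSup_le_iff]
    exact fun q w h => span_le_of_ιMulti_eq v w h0 h.2
  · exact le_iSup₂_of_le p v (le_iSup_of_le ⟨h0, rfl⟩ le_rfl)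

theorem bladeSpace_algebraMap (c : 𝕜) :
    bladeSpace (algebraMap 𝕜 (ExteriorAlgebra 𝕜 X) c) = ⊥ := by
  rw [eq_bot_iff]
  simp only [bladeSpace, iSup_le_iff]
  rintro (_ | p) v ⟨h0, h⟩
  · simp [Set.range_eq_empty]
  · exfalso
    apply h0
    rw [← inner_self_eq_zero (𝕜 := 𝕜)]
    nth_rw 1 [h]
    rw [Algebra.algebraMap_eq_smul_one, inner_smul_right, ← ιMulti_zero_apply (![] : Fin 0 → X)]
    exact mul_eq_zero_of_right _ (innerForm_ne (by simp) v _)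

/-- Associated principal bases `(e₁, …, e_p)` of `V` and `(f₁, …, f_q)` of `W`, with principal angles
`0 ≤ θ₁ ≤ ⋯ ≤ θ_m ≤ π/2`, `m = min p q`. If `V` or `W` is `{0}`, these are any orthonormal bases. -/
structure IsPrincipalBases (V W : Submodule 𝕜 X) {p q : ℕ} (e : Fin p → X) (f : Fin q → X) :
    Prop where
  orthonormal_left : Orthonormal 𝕜 e
  span_left : Submodule.span 𝕜 (Set.range e) = V
  orthonormal_right : Orthonormal 𝕜 f
  span_right : Submodule.span 𝕜 (Set.range f) = W
  inner_eq_zero : ∀ (i : Fin p) (j : Fin q), (i : ℕ) ≠ (j : ℕ) → inner 𝕜 (e i) (f j) = 0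
  principal_angles : ∃ θ : Fin (min p q) → ℝ, Monotone θ ∧
    (∀ i, θ i ∈ Set.Icc 0 (Real.pi / 2)) ∧
    ∀ i, inner 𝕜 (e (Fin.castLE (min_le_left p q) i)) (f (Fin.castLE (min_le_right p q) i)) =
      (Real.cos (θ i) : 𝕜)

/-- `B = B_P ∧ B_⊥` is a projective-orthogonal factorization of `B` with respect to `A`:
`B_P = ε ‖B‖ f₁ ∧ ⋯ ∧ f_m` and `B_⊥ = f_{m+1} ∧ ⋯ ∧ f_q`, where `(f₁, …, f_q)` is a principal basis of
`[B]` with respect to `[A]`, `m = min p q` and `ε` is a unit scalar. -/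
def IsPOFactorization (A B BP Bperp : ExteriorAlgebra 𝕜 X) : Prop :=
  ∃ (p q : ℕ) (e : Fin p → X) (f : Fin q → X) (ε : 𝕜),
    IsPrincipalBases (bladeSpace A) (bladeSpace B) e f ∧ ‖ε‖ = 1 ∧
    BP = (ε * (‖B‖ : 𝕜)) • ιMulti 𝕜 (min p q) (fun i => f (Fin.castLE (min_le_right p q) i)) ∧
    Bperp = ιMulti 𝕜 (q - min p q)
      (fun i => f ⟨min p q + i, by have := i.isLt; omega⟩) ∧
    B = BP * Bperp

/-- `Θ` is an asymmetric angle of `V = [A]` with `W = [B]`, computed from some nonzero blades `A`, `B` and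
some projective-orthogonal factorization `B = B_P ∧ B_⊥` with respect to `A`. -/
def IsAsymmetricAngle (V W : Submodule 𝕜 X) (Θ : ℝ) : Prop :=
  ∃ A B BP Bperp : ExteriorAlgebra 𝕜 X,
    IsBlade A ∧ A ≠ 0 ∧ bladeSpace A = V ∧ IsBlade B ∧ B ≠ 0 ∧ bladeSpace B = W ∧
    IsPOFactorization A B BP Bperp ∧ Θ = Real.arccos (‖inner 𝕜 A BP‖ / (‖A‖ * ‖B‖))

open Classical in
/-- The asymmetric angle `Θ_{V,W}`: the angle above, which does not depend on the choices. -/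
def asymmetricAngle (V W : Submodule 𝕜 X) : ℝ :=
  if h : ∃! Θ : ℝ, IsAsymmetricAngle V W Θ then h.choose else 0

end Grassmann
end

/-!
The star sends a blade to a blade of the same norm whose space is the orthogonal complement, so
that `‖A ∨ B‖ = ‖A⋆ ∧ B⋆‖`, and everything reduces to the norm of an exterior product of two blades
`C` and `D`. Multiplying by `D` kills the vectors of `[D]`, hence `C ∧ D = (P C) ∧ D`, where `P` is
induced by the orthogonal projection onto `[D]ᗮ`, and `‖(P C) ∧ D‖ = ‖P C‖ ‖D‖` by
orthogonality. Finally `‖P C‖ = ‖C‖ cos Θ`, where `Θ` is the asymmetric angle of `[C]` with `[D]ᗮ`: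
in principal bases `e_i` of `[C]` and `f_i` of `[D]ᗮ`, the projection maps `e_i` to `cos θ_i • f_i`,
or to `0` if there is no `f_i`.
-/

namespace Grassmann

open ExteriorAlgebra Module

section CommRing

variable {R E : Type*} [CommRing R] [AddCommGroup E] [Module R E]

theorem ιMulti_comp_cast {m n : ℕ} (h : m = n) (v : Fin n → E) :
    ιMulti R m (fun i => v (Fin.cast h i)) = ιMulti R n v := by
  subst h
  rfl

theorem ι_mul_ιMulti {p : ℕ} (x : E) (v : Fin p → E) :
    ι R x * ιMulti R p v = ιMulti R (p + 1) (Fin.cons x v) :=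
  (ιMulti_succ_apply (Fin.cons x v)).symm

theorem ι_mul_mul_eq_zero {x : E} {B : ExteriorAlgebra R E} (hB : ι R x * B = 0)
    (M : ExteriorAlgebra R E) : ι R x * (M * B) = 0 := by
  induction M using ExteriorAlgebra.induction generalizing B with
  | algebraMap c => rw [← Algebra.smul_def, mul_smul_comm, hB, smul_zero]
  | ι y =>
    rw [← mul_assoc, eq_neg_of_add_eq_zero_left (ι_add_mul_swap x y), neg_mul, mul_assoc, hB,
      mul_zero, neg_zero]
  | mul M N hM hN => rw [mul_assoc, hM (hN hB)]
  | add M N hM hN => rw [add_mul, mul_add, hM hB, hN hB, add_zero]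

theorem map_mul_eq_mul {f : E →ₗ[R] E} {B : ExteriorAlgebra R E}
    (hB : ∀ x, ι R (f x - x) * B = 0) (M : ExteriorAlgebra R E) : map f M * B = M * B := by
  induction M using ExteriorAlgebra.induction generalizing B with
  | algebraMap c => rw [AlgHom.commutes]
  | ι x => rw [map_apply_ι, ← sub_eq_zero, ← sub_mul, ← map_sub, hB]
  | mul M N hM hN =>
    rw [map_mul, mul_assoc, hN hB, hM fun x => ι_mul_mul_eq_zero (hB x) N, mul_assoc]
  | add M N hM hN => rw [map_add, add_mul, add_mul, hM hB, hN hB]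

end CommRing

section Field

variable {K E : Type*} [Field K] [AddCommGroup E] [Module K E]

theorem exists_smul_eq_of_mem_exteriorPower_finrank [FiniteDimensional K E]
    {M N : ExteriorAlgebra K E} (hM : M ∈ ⋀[K]^(finrank K E) E) (hM0 : M ≠ 0)
    (hN : N ∈ ⋀[K]^(finrank K E) E) : ∃ c : K, c • M = N := by
  have hrank : finrank K (⋀[K]^(finrank K E) E) = 1 := by
    rw [exteriorPower.finrank_eq, Nat.choose_self]
  obtain ⟨c, hc⟩ := (finrank_eq_one_iff_of_nonzero' (⟨M, hM⟩ : ⋀[K]^(finrank K E) E)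
    fun h => hM0 (congrArg Subtype.val h)).mp hrank ⟨N, hN⟩
  exact ⟨c, congrArg Subtype.val hc⟩

theorem exists_smul_ιMulti_eq {p : ℕ} {v w : Fin p → E} (hv : ιMulti K p v ≠ 0)
    (hw : ∀ i, w i ∈ Submodule.span K (Set.range v)) :
    ∃ c : K, c • ιMulti K p v = ιMulti K p w := by
  let V := Submodule.span K (Set.range v)
  let v' : Fin p → V := fun i => ⟨v i, Submodule.subset_span ⟨i, rfl⟩⟩
  let w' : Fin p → V := fun i => ⟨w i, hw i⟩
  have hmap (u : Fin p → V) :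
      map V.subtype (ιMulti K p u) = ιMulti K p (fun i => (u i : E)) :=
    map_apply_ιMulti V.subtype u
  have : FiniteDimensional K V := FiniteDimensional.span_of_finite K (Set.finite_range v)
  have hv' : ιMulti K p v' ≠ 0 := fun h => hv (by rw [← map_zero (map V.subtype), ← h, hmap])
  have hli : LinearIndependent K v := by_contra fun h => hv ((ιMulti K p).map_linearDependent v h)
  have hrank : finrank K V = p := by rw [finrank_span_eq_card hli, Fintype.card_fin]
  have hmem (u : Fin p → V) : ιMulti K p u ∈ ⋀[K]^(finrank K V) V := by
    rw [hrank]
    exact ιMulti_range K p ⟨u, rfl⟩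
  obtain ⟨c, hc⟩ := exists_smul_eq_of_mem_exteriorPower_finrank (hmem v') hv' (hmem w')
  exact ⟨c, by simpa only [map_smul, hmap] using congrArg (map V.subtype) hc⟩

end Field

variable {𝕜 X : Type*} [RCLike 𝕜] [NormedAddCommGroup X] [InnerProductSpace 𝕜 X]

section Orthonormal

theorem span_range_coe_orthonormalBasis {J : Type*} [Fintype J] {V : Submodule 𝕜 X}
    (b : OrthonormalBasis J 𝕜 V) : Submodule.span 𝕜 (Set.range fun i => (b i : X)) = V := by
  have h := congrArg (Submodule.map V.subtype) b.toBasis.span_eq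
  rw [Submodule.map_span, Submodule.map_top, Submodule.range_subtype, ← Set.range_comp] at h
  simpa [Function.comp_def] using h

theorem exists_orthonormal_span_range_eq (V : Submodule 𝕜 X) [FiniteDimensional 𝕜 V] :
    ∃ (p : ℕ) (v : Fin p → X), Orthonormal 𝕜 v ∧ Submodule.span 𝕜 (Set.range v) = V :=
  ⟨finrank 𝕜 V, fun i => stdOrthonormalBasis 𝕜 V i,
    (stdOrthonormalBasis 𝕜 V).orthonormal.comp_linearIsometry V.subtypeₗᵢ,
    span_range_coe_orthonormalBasis _⟩

theorem starProjection_span_range_apply {J : Type*} [Fintype J] {f : J → X}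
    (hf : Orthonormal 𝕜 f) [(Submodule.span 𝕜 (Set.range f)).HasOrthogonalProjection] (x : X) :
    (Submodule.span 𝕜 (Set.range f)).starProjection x = ∑ j, inner 𝕜 (f j) x • f j := by
  have hortho : 𝕜 ∙ (x - ∑ j, inner 𝕜 (f j) x • f j) ⟂ Submodule.span 𝕜 (Set.range f) := by
    rw [Submodule.isOrtho_span]
    rintro _ rfl _ ⟨j, rfl⟩
    rw [inner_sub_left, hf.inner_left_fintype, inner_conj_symm, sub_self]
  refine Submodule.eq_starProjection_of_mem_of_inner_eq_zero
    (Submodule.sum_mem _ fun j _ => Submodule.smul_mem _ _ (Submodule.subset_span ⟨j, rfl⟩))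
    fun y hy => hortho.inner_eq (Submodule.mem_span_singleton_self _) hy

theorem inner_eq_zero_of_span_eq_orthogonal {J K : Type*} {v : J → X} {g : K → X}
    (h : Submodule.span 𝕜 (Set.range g) = (Submodule.span 𝕜 (Set.range v))ᗮ) (j : J) (k : K) :
    inner 𝕜 (v j) (g k) = 0 :=
  Submodule.inner_right_of_mem_orthogonal (Submodule.subset_span (Set.mem_range_self j))
    (h ▸ Submodule.subset_span (Set.mem_range_self k))

end Orthonormal

section InnerProduct

variable [FiniteDimensional 𝕜 X]

theorem inner_ιMulti_of_ne {p q : ℕ} (h : p ≠ q) (v : Fin p → X) (w : Fin q → X) :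
    inner 𝕜 (ιMulti 𝕜 p v) (ιMulti 𝕜 q w) = 0 :=
  innerForm_ne h v w

theorem inner_ιMulti_of_pairwise_inner_eq_zero {p : ℕ} {v w : Fin p → X}
    (h : Pairwise fun i j => inner 𝕜 (v i) (w j) = 0) :
    inner 𝕜 (ιMulti 𝕜 p v) (ιMulti 𝕜 p w) = ∏ i, inner 𝕜 (v i) (w i) := by
  rw [inner_ιMulti, ← Matrix.det_diagonal]
  congr 1
  ext i j
  rcases eq_or_ne i j with rfl | hij
  · rw [Matrix.of_apply, Matrix.diagonal_apply_eq]
  · rw [Matrix.of_apply, h hij, Matrix.diagonal_apply_ne _ hij]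

theorem norm_ιMulti_of_orthonormal {p : ℕ} {v : Fin p → X} (hv : Orthonormal 𝕜 v) :
    ‖ιMulti 𝕜 p v‖ = 1 := by
  have h : inner 𝕜 (ιMulti 𝕜 p v) (ιMulti 𝕜 p v) = (1 : 𝕜) := by
    simp only [inner_ιMulti_of_pairwise_inner_eq_zero hv.2, inner_self_eq_norm_sq_to_K, hv.1,
      map_one, one_pow, Finset.prod_const_one]
  rw [inner_self_eq_norm_sq_to_K] at h
  exact (pow_eq_one_iff_of_nonneg (norm_nonneg _) two_ne_zero).mp (by exact_mod_cast h)

theorem inner_ιMulti_mul_ιMulti {p q r : ℕ} {v w : Fin p → X} {v' : Fin q → X} {w' : Fin r → X}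
    (h : ∀ i j, inner 𝕜 (v i) (w' j) = 0) :
    inner 𝕜 (ιMulti 𝕜 p v * ιMulti 𝕜 q v') (ιMulti 𝕜 p w * ιMulti 𝕜 r w') =
      inner 𝕜 (ιMulti 𝕜 p v) (ιMulti 𝕜 p w) * inner 𝕜 (ιMulti 𝕜 q v') (ιMulti 𝕜 r w') := by
  rw [ιMulti_mul_ιMulti, ιMulti_mul_ιMulti]
  rcases ne_or_eq q r with hqr | rfl
  · rw [inner_ιMulti_of_ne hqr, mul_zero, inner_ιMulti_of_ne (by omega)]
  · rw [inner_ιMulti, inner_ιMulti, inner_ιMulti, ← Matrix.det_submatrix_equiv_self finSumFinEquiv,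
      ← Matrix.det_fromBlocks_zero₁₂ _ (Matrix.of fun i j => inner 𝕜 (v' i) (w j))]
    congr 1
    ext (i | i) (j | j) <;> simp [h]

theorem norm_ιMulti_mul_ιMulti {p q : ℕ} {v : Fin p → X} {w : Fin q → X}
    (h : ∀ i j, inner 𝕜 (v i) (w j) = 0) :
    ‖ιMulti 𝕜 p v * ιMulti 𝕜 q w‖ = ‖ιMulti 𝕜 p v‖ * ‖ιMulti 𝕜 q w‖ := by
  have hinner := inner_ιMulti_mul_ιMulti (v := v) (w := v) (v' := w) (w' := w) h
  simp only [inner_self_eq_norm_sq_to_K, ← mul_pow] at hinner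
  exact (pow_left_inj₀ (norm_nonneg _) (by positivity) two_ne_zero).mp (by exact_mod_cast hinner)

theorem ext_inner_ιMulti {M N : ExteriorAlgebra 𝕜 X}
    (h : ∀ (p : ℕ) (v : Fin p → X), inner 𝕜 (ιMulti 𝕜 p v) M = inner 𝕜 (ιMulti 𝕜 p v) N) :
    M = N := by
  refine ext_inner_left 𝕜 fun L => ?_
  have hL : L ∈ Submodule.span 𝕜 (Set.range fun x : Σ p, Fin p → X => ιMulti 𝕜 x.1 x.2) :=
    ιMulti_span 𝕜 X ▸ Submodule.mem_top
  induction hL using Submodule.span_induction with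
  | mem L hL =>
    obtain ⟨⟨p, v⟩, rfl⟩ := hL
    exact h p v
  | zero => rw [inner_zero_left, inner_zero_left]
  | add L L' _ _ hL hL' => rw [inner_add_left, inner_add_left, hL, hL']
  | smul c L _ hL => rw [inner_smul_left, inner_smul_left, hL]

theorem leftContraction_smul_right (c : 𝕜) (M N : ExteriorAlgebra 𝕜 X) :
    leftContraction M (c • N) = c • leftContraction M N :=
  map_smul _ c N

theorem leftContraction_ιMulti_mul {p q : ℕ} {v w : Fin p → X} {w' : Fin q → X}
    (h : ∀ i j, inner 𝕜 (v i) (w' j) = 0) :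
    leftContraction (ιMulti 𝕜 p v) (ιMulti 𝕜 p w * ιMulti 𝕜 q w') =
      inner 𝕜 (ιMulti 𝕜 p v) (ιMulti 𝕜 p w) • ιMulti 𝕜 q w' :=
  ext_inner_ιMulti fun _ _ => by
    rw [inner_leftContraction, inner_ιMulti_mul_ιMulti h, inner_smul_right]

end InnerProduct

section Blade

theorem isBlade_ιMulti {p : ℕ} (v : Fin p → X) : IsBlade (ιMulti 𝕜 p v) :=
  Or.inr ⟨p, v, rfl⟩

protected theorem IsBlade.smul {A : ExteriorAlgebra 𝕜 X} (hA : IsBlade A) (c : 𝕜) :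
    IsBlade (c • A) := by
  rcases hA with ⟨d, rfl⟩ | ⟨_ | p, v, rfl⟩
  · exact Or.inl ⟨c * d, by rw [map_mul, Algebra.smul_def]⟩
  · exact Or.inl ⟨c, by rw [ιMulti_zero_apply, Algebra.algebraMap_eq_smul_one]⟩
  · refine Or.inr ⟨p + 1, Function.update v 0 (c • v 0), ?_⟩
    rw [(ιMulti 𝕜 (p + 1)).map_update_smul, Function.update_eq_self]

protected theorem IsBlade.mul {A B : ExteriorAlgebra 𝕜 X} (hA : IsBlade A) (hB : IsBlade B) :
    IsBlade (A * B) := by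
  rcases hA with ⟨c, rfl⟩ | ⟨p, v, rfl⟩
  · exact Algebra.smul_def c B ▸ hB.smul c
  rcases hB with ⟨c, rfl⟩ | ⟨q, w, rfl⟩
  · rw [← Algebra.commutes, ← Algebra.smul_def]
    exact (isBlade_ιMulti v).smul c
  · exact ιMulti_mul_ιMulti (R := 𝕜) v w ▸ isBlade_ιMulti _

variable [FiniteDimensional 𝕜 X] {A : ExteriorAlgebra 𝕜 X}

theorem bladeSpace_ιMulti_of_orthonormal {p : ℕ} {v : Fin p → X} (hv : Orthonormal 𝕜 v) :
    bladeSpace (ιMulti 𝕜 p v) = Submodule.span 𝕜 (Set.range v) :=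
  bladeSpace_ιMulti v ((ιMulti_ne_zero_iff v).mpr hv.linearIndependent)

theorem IsBlade.mem_bladeSpace_iff (hA : IsBlade A) (hA0 : A ≠ 0) {x : X} :
    x ∈ bladeSpace A ↔ ι 𝕜 x * A = 0 := by
  rcases hA with ⟨c, rfl⟩ | ⟨p, v, rfl⟩
  · have hc : c ≠ 0 := fun h => hA0 (by rw [h, map_zero])
    rw [bladeSpace_algebraMap, Submodule.mem_bot, ← Algebra.commutes, ← Algebra.smul_def,
      smul_eq_zero_iff_right hc, ι_eq_zero_iff]
  · have hv := (ιMulti_ne_zero_iff v).mp hA0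
    rw [bladeSpace_ιMulti v hA0, ι_mul_ιMulti, ← not_iff_not, ← ne_eq (ιMulti _ _ _),
      ιMulti_ne_zero_iff, linearIndependent_finCons, and_iff_right hv]

theorem IsBlade.bladeSpace_smul (hA : IsBlade A) {c : 𝕜} (hc : c ≠ 0) :
    bladeSpace (c • A) = bladeSpace A := by
  rcases eq_or_ne A 0 with rfl | hA0
  · rw [smul_zero]
  · ext x
    rw [(hA.smul c).mem_bladeSpace_iff (smul_ne_zero hc hA0), hA.mem_bladeSpace_iff hA0,
      mul_smul_comm, smul_eq_zero_iff_right hc]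

theorem IsBlade.exists_eq_smul_ιMulti (hA : IsBlade A) {p : ℕ} {v : Fin p → X}
    (hv : Orthonormal 𝕜 v) (hspan : Submodule.span 𝕜 (Set.range v) = bladeSpace A) :
    ∃ c : 𝕜, ‖c‖ = ‖A‖ ∧ A = c • ιMulti 𝕜 p v := by
  suffices h : ∃ c : 𝕜, c • ιMulti 𝕜 p v = A by
    obtain ⟨c, rfl⟩ := h
    exact ⟨c, by rw [norm_smul, norm_ιMulti_of_orthonormal hv, mul_one], rfl⟩
  rcases eq_or_ne A 0 with rfl | hA0
  · exact ⟨0, zero_smul _ _⟩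
  have hp : p = finrank 𝕜 (bladeSpace A) := by
    rw [← hspan, finrank_span_eq_card hv.linearIndependent, Fintype.card_fin]
  rcases hA with ⟨c, rfl⟩ | ⟨k, w, rfl⟩
  · rw [bladeSpace_algebraMap, finrank_bot] at hp
    subst hp
    exact ⟨c, by rw [ιMulti_zero_apply, Algebra.algebraMap_eq_smul_one]⟩
  · rw [bladeSpace_ιMulti w hA0] at hspan hp
    rw [finrank_span_eq_card ((ιMulti_ne_zero_iff w).mp hA0), Fintype.card_fin] at hp
    subst hp
    exact exists_smul_ιMulti_eq ((ιMulti_ne_zero_iff v).mpr hv.linearIndependent) fun i =>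
      hspan ▸ Submodule.subset_span (Set.mem_range_self i)

end Blade

section Star

variable [FiniteDimensional 𝕜 X] {Ω A B : ExteriorAlgebra 𝕜 X}

theorem rightStar_smul (Ω : ExteriorAlgebra 𝕜 X) (c : 𝕜) (M : ExteriorAlgebra 𝕜 X) :
    rightStar Ω (c • M) = starRingEnd 𝕜 c • rightStar Ω M :=
  ext_inner_left 𝕜 fun L => by
    rw [inner_smul_right, rightStar, rightStar, inner_leftContraction, inner_leftContraction,
      smul_mul_assoc, inner_smul_left]

theorem IsOrientation.exists_eq_smul (hΩ : IsOrientation Ω) {N : ExteriorAlgebra 𝕜 X}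
    (hN : N ∈ ⋀[𝕜]^(finrank 𝕜 X) X) (hN1 : ‖N‖ = 1) : ∃ u : 𝕜, ‖u‖ = 1 ∧ Ω = u • N := by
  obtain ⟨u, rfl⟩ := exists_smul_eq_of_mem_exteriorPower_finrank hN
    (norm_ne_zero_iff.mp (hN1 ▸ one_ne_zero)) hΩ.mem
  have hu := hΩ.norm_eq_one
  rw [norm_smul, hN1, mul_one] at hu
  exact ⟨u, hu, rfl⟩

theorem IsOrientation.exists_rightStar_ιMulti_eq_smul (hΩ : IsOrientation Ω) {p q : ℕ}
    {v : Fin p → X} {g : Fin q → X} (hv : Orthonormal 𝕜 v) (hg : Orthonormal 𝕜 g)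
    (hspan : Submodule.span 𝕜 (Set.range g) = (Submodule.span 𝕜 (Set.range v))ᗮ) :
    ∃ u : 𝕜, ‖u‖ = 1 ∧ rightStar Ω (ιMulti 𝕜 p v) = u • ιMulti 𝕜 q g := by
  have hvg := inner_eq_zero_of_span_eq_orthogonal hspan
  have hdim : p + q = finrank 𝕜 X := by
    rw [← Submodule.finrank_add_finrank_orthogonal (Submodule.span 𝕜 (Set.range v)), ← hspan,
      finrank_span_eq_card hv.linearIndependent, finrank_span_eq_card hg.linearIndependent,
      Fintype.card_fin, Fintype.card_fin]
  have htop : ιMulti 𝕜 p v * ιMulti 𝕜 q g ∈ ⋀[𝕜]^(finrank 𝕜 X) X := by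
    rw [ιMulti_mul_ιMulti, ← hdim]
    exact ιMulti_range 𝕜 _ (Set.mem_range_self _)
  have hnorm : ‖ιMulti 𝕜 p v * ιMulti 𝕜 q g‖ = 1 := by
    rw [norm_ιMulti_mul_ιMulti hvg, norm_ιMulti_of_orthonormal hv, norm_ιMulti_of_orthonormal hg,
      mul_one]
  obtain ⟨u, hu, rfl⟩ := hΩ.exists_eq_smul htop hnorm
  refine ⟨u, hu, ?_⟩
  rw [rightStar, leftContraction_smul_right, leftContraction_ιMulti_mul hvg,
    inner_self_eq_norm_sq_to_K, norm_ιMulti_of_orthonormal hv, RCLike.ofReal_one, one_pow, one_smul]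

theorem IsBlade.exists_rightStar_eq_smul (hΩ : IsOrientation Ω) (hA : IsBlade A) {q : ℕ}
    {g : Fin q → X} (hg : Orthonormal 𝕜 g)
    (hspan : Submodule.span 𝕜 (Set.range g) = (bladeSpace A)ᗮ) :
    ∃ c : 𝕜, ‖c‖ = ‖A‖ ∧ rightStar Ω A = c • ιMulti 𝕜 q g := by
  obtain ⟨p, v, hv, hvA⟩ := exists_orthonormal_span_range_eq (bladeSpace A)
  obtain ⟨c, hc, rfl⟩ := hA.exists_eq_smul_ιMulti hv hvA
  obtain ⟨u, hu, hstar⟩ := hΩ.exists_rightStar_ιMulti_eq_smul hv hg (hvA ▸ hspan)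
  refine ⟨starRingEnd 𝕜 c * u, ?_, by rw [rightStar_smul, hstar, smul_smul]⟩
  rw [norm_mul, RCLike.norm_conj, hc, hu, mul_one]

protected theorem IsBlade.rightStar (hΩ : IsOrientation Ω) (hA : IsBlade A) :
    IsBlade (rightStar Ω A) := by
  obtain ⟨q, g, hg, hspan⟩ := exists_orthonormal_span_range_eq (bladeSpace A)ᗮ
  obtain ⟨c, -, hc⟩ := hA.exists_rightStar_eq_smul hΩ hg hspan
  exact hc ▸ (isBlade_ιMulti g).smul c

theorem IsBlade.norm_rightStar (hΩ : IsOrientation Ω) (hA : IsBlade A) :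
    ‖rightStar Ω A‖ = ‖A‖ := by
  obtain ⟨q, g, hg, hspan⟩ := exists_orthonormal_span_range_eq (bladeSpace A)ᗮ
  obtain ⟨c, hc, hstar⟩ := hA.exists_rightStar_eq_smul hΩ hg hspan
  rw [hstar, norm_smul, norm_ιMulti_of_orthonormal hg, mul_one, hc]

theorem IsBlade.bladeSpace_rightStar (hΩ : IsOrientation Ω) (hA : IsBlade A) (hA0 : A ≠ 0) :
    bladeSpace (rightStar Ω A) = (bladeSpace A)ᗮ := by
  obtain ⟨q, g, hg, hspan⟩ := exists_orthonormal_span_range_eq (bladeSpace A)ᗮ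
  obtain ⟨c, hc, hstar⟩ := hA.exists_rightStar_eq_smul hΩ hg hspan
  have hc0 : c ≠ 0 := norm_ne_zero_iff.mp (hc ▸ norm_ne_zero_iff.mpr hA0)
  rw [hstar, (isBlade_ιMulti g).bladeSpace_smul hc0, bladeSpace_ιMulti_of_orthonormal hg, hspan]

theorem IsBlade.exists_rightStar_eq (hΩ : IsOrientation Ω) (hA : IsBlade A) :
    ∃ R, IsBlade R ∧ rightStar Ω R = A := by
  obtain ⟨p, v, hv, hvA⟩ := exists_orthonormal_span_range_eq (bladeSpace A)
  obtain ⟨q, g, hg, hgA⟩ := exists_orthonormal_span_range_eq (bladeSpace A)ᗮ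
  obtain ⟨c, -, hc⟩ := hA.exists_eq_smul_ιMulti hv hvA
  obtain ⟨u, hu, hstar⟩ := hΩ.exists_rightStar_ιMulti_eq_smul hg hv
    (by rw [hvA, hgA, Submodule.orthogonal_orthogonal])
  have hu0 : u ≠ 0 := norm_ne_zero_iff.mp (hu ▸ one_ne_zero)
  refine ⟨starRingEnd 𝕜 (c / u) • ιMulti 𝕜 _ g, (isBlade_ιMulti g).smul _, ?_⟩
  rw [rightStar_smul, RCLike.conj_conj, hstar, smul_smul, div_mul_cancel₀ c hu0, hc]

theorem norm_regressive (hΩ : IsOrientation Ω) (hA : IsBlade A) (hB : IsBlade B) :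
    ‖regressive Ω A B‖ = ‖rightStar Ω A * rightStar Ω B‖ := by
  obtain ⟨R, hR, hstar⟩ := ((hA.rightStar hΩ).mul (hB.rightStar hΩ)).exists_rightStar_eq hΩ
  rw [(regressive_eq_iff hΩ A B R).mpr hstar, ← hR.norm_rightStar hΩ, hstar]

end Star

section SingularValues

variable {E F : Type*} [NormedAddCommGroup E] [InnerProductSpace 𝕜 E] [FiniteDimensional 𝕜 E]
  [NormedAddCommGroup F] [InnerProductSpace 𝕜 F] [FiniteDimensional 𝕜 F]

theorem exists_orthonormalBasis_eq_norm_smul {n : ℕ} (hn : finrank 𝕜 F = n) {x : Fin n → F}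
    (hx : Pairwise fun i j => inner 𝕜 (x i) (x j) = 0) :
    ∃ f : OrthonormalBasis (Fin n) 𝕜 F, ∀ i, x i = (‖x i‖ : 𝕜) • f i := by
  have hcard : finrank 𝕜 F = Fintype.card (Fin n) := by rw [hn, Fintype.card_fin]
  refine ⟨InnerProductSpace.gramSchmidtOrthonormalBasis hcard x, fun i => ?_⟩
  rcases eq_or_ne (x i) 0 with hi | hi
  · rw [hi, norm_zero, RCLike.ofReal_zero, zero_smul]
  · rw [InnerProductSpace.gramSchmidtOrthonormalBasis_apply_of_orthogonal hcard hx hi,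
      smul_inv_smul₀ (by simpa using hi)]

theorem exists_orthonormalBasis_inner_map_eq (T : E →ₗ[𝕜] F) :
    ∃ e : OrthonormalBasis (Fin (finrank 𝕜 E)) 𝕜 E, ∀ i j, inner 𝕜 (T (e i)) (T (e j)) =
      if i = j then ((T.singularValues i : ℝ) : 𝕜) ^ 2 else 0 := by
  let hT := T.isSymmetric_adjoint_comp_self
  refine ⟨hT.eigenvectorBasis rfl, fun i j => ?_⟩
  rw [← LinearMap.adjoint_inner_right, ← LinearMap.comp_apply, hT.apply_eigenvectorBasis rfl j,
    inner_smul_right, orthonormal_iff_ite.mp (hT.eigenvectorBasis rfl).orthonormal]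
  rcases eq_or_ne i j with rfl | hij
  · rw [if_pos rfl, if_pos rfl, mul_one, ← T.sq_singularValues_fin rfl i, RCLike.ofReal_pow]
  · rw [if_neg hij, if_neg hij, mul_zero]

theorem exists_orthonormalBasis_inner_map_eq_singularValues (T : E →ₗ[𝕜] F) :
    ∃ (e : OrthonormalBasis (Fin (finrank 𝕜 E)) 𝕜 E) (f : OrthonormalBasis (Fin (finrank 𝕜 F)) 𝕜 F),
      ∀ i j, inner 𝕜 (T (e i)) (f j) =
        if (i : ℕ) = j then ((T.singularValues i : ℝ) : 𝕜) else 0 := by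
  obtain ⟨e, he⟩ := exists_orthonormalBasis_inner_map_eq T
  have hnorm (i) : ‖T (e i)‖ = T.singularValues i := by
    have h := he i i
    rw [if_pos rfl, inner_self_eq_norm_sq_to_K] at h
    exact (pow_left_inj₀ (norm_nonneg _) (T.singularValues_nonneg _) two_ne_zero).mp
      (by exact_mod_cast h)
  let x (j : Fin (finrank 𝕜 F)) : F := if h : (j : ℕ) < finrank 𝕜 E then T (e ⟨j, h⟩) else 0
  have hx : Pairwise fun i j => inner 𝕜 (x i) (x j) = 0 := by
    intro i j hij
    by_cases hi : (i : ℕ) < finrank 𝕜 E <;> by_cases hj : (j : ℕ) < finrank 𝕜 E <;>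
      simp [x, hi, hj, he, Fin.val_inj, hij]
  obtain ⟨f, hf⟩ := exists_orthonormalBasis_eq_norm_smul rfl hx
  refine ⟨e, f, fun i j => ?_⟩
  by_cases hi : (i : ℕ) < finrank 𝕜 F
  · have hTe : T (e i) = ((T.singularValues i : ℝ) : 𝕜) • f ⟨i, hi⟩ := by
      simpa only [x, i.isLt, dif_pos, hnorm] using hf ⟨i, hi⟩
    rw [hTe, inner_smul_left, orthonormal_iff_ite.mp f.orthonormal, RCLike.conj_ofReal, mul_ite,
      mul_one, mul_zero]
    simp only [Fin.ext_iff]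
  · have hσ : T.singularValues i = 0 := by
      rw [LinearMap.singularValues_eq_zero_iff_le_finrank_range]
      exact (Submodule.finrank_le _).trans (not_lt.mp hi)
    rw [norm_eq_zero.mp ((hnorm i).trans hσ), inner_zero_left, if_neg (by omega)]

end SingularValues

section PrincipalBases

theorem isPrincipalBases_of_inner_eq {p q : ℕ} {e : Fin p → X} {f : Fin q → X}
    (he : Orthonormal 𝕜 e) (hf : Orthonormal 𝕜 f) {s : ℕ → ℝ} (hs : Antitone s)
    (hs0 : ∀ i, 0 ≤ s i)
    (hef : ∀ i j, inner 𝕜 (e i) (f j) = if (i : ℕ) = j then (s i : 𝕜) else 0) :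
    IsPrincipalBases (Submodule.span 𝕜 (Set.range e)) (Submodule.span 𝕜 (Set.range f)) e f where
  orthonormal_left := he
  span_left := rfl
  orthonormal_right := hf
  span_right := rfl
  inner_eq_zero i j hij := by rw [hef, if_neg hij]
  principal_angles := by
    refine ⟨fun i => Real.arccos (s i), fun i j hij => Real.arccos_le_arccos (hs hij),
      fun i => ⟨Real.arccos_nonneg _, Real.arccos_le_pi_div_two.mpr (hs0 i)⟩, fun i => ?_⟩
    have hi := hef (Fin.castLE (min_le_left p q) i) (Fin.castLE (min_le_right p q) i)
    simp only [Fin.val_castLE, if_true] at hi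
    have hle : s i ≤ 1 := by
      have h := norm_inner_le_norm (𝕜 := 𝕜) (e (Fin.castLE (min_le_left p q) i))
        (f (Fin.castLE (min_le_right p q) i))
      rwa [hi, he.1, hf.1, mul_one, RCLike.norm_ofReal, abs_of_nonneg (hs0 i)] at h
    rw [hi, Real.cos_arccos (by linarith [hs0 i]) hle]

theorem exists_isPrincipalBases (V W : Submodule 𝕜 X) [FiniteDimensional 𝕜 V]
    [FiniteDimensional 𝕜 W] :
    ∃ (p q : ℕ) (e : Fin p → X) (f : Fin q → X), IsPrincipalBases V W e f := by
  let T : V →ₗ[𝕜] W := W.orthogonalProjectionOnto.toLinearMap ∘ₗ V.subtype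
  obtain ⟨e, f, hef⟩ := exists_orthonormalBasis_inner_map_eq_singularValues T
  have h := isPrincipalBases_of_inner_eq (e.orthonormal.comp_linearIsometry V.subtypeₗᵢ)
    (f.orthonormal.comp_linearIsometry W.subtypeₗᵢ) T.singularValues_antitone
    T.singularValues_nonneg fun i j =>
      (Submodule.inner_orthogonalProjectionOnto_eq_of_mem_right (f j) (e i : X)).symm.trans
        (hef i j)
  have hV := span_range_coe_orthonormalBasis e
  have hW := span_range_coe_orthonormalBasis f
  exact ⟨_, _, _, _, hV ▸ hW ▸ h⟩

variable {V W : Submodule 𝕜 X} {p q : ℕ} {e : Fin p → X} {f : Fin q → X}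

theorem IsPrincipalBases.starProjection_eq_smul [W.HasOrthogonalProjection]
    (h : IsPrincipalBases V W e f) (i : Fin p) (hi : (i : ℕ) < q) :
    W.starProjection (e i) = inner 𝕜 (f ⟨i, hi⟩) (e i) • f ⟨i, hi⟩ := by
  obtain rfl := h.span_right
  rw [starProjection_span_range_apply h.orthonormal_right]
  refine Finset.sum_eq_single_of_mem _ (Finset.mem_univ _) fun j _ hj => ?_
  rw [inner_eq_zero_symm.mp (h.inner_eq_zero i j fun hij => hj (Fin.ext hij.symm)), zero_smul]

theorem IsPrincipalBases.starProjection_eq_zero [W.HasOrthogonalProjection]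
    (h : IsPrincipalBases V W e f) (i : Fin p) (hi : q ≤ i) : W.starProjection (e i) = 0 := by
  obtain rfl := h.span_right
  rw [starProjection_span_range_apply h.orthonormal_right]
  refine Finset.sum_eq_zero fun j _ => ?_
  rw [inner_eq_zero_symm.mp (h.inner_eq_zero i j (j.isLt.trans_le hi).ne'), zero_smul]

end PrincipalBases

section AsymmetricAngle

variable [FiniteDimensional 𝕜 X] {V W : Submodule 𝕜 X} {A B : ExteriorAlgebra 𝕜 X} {Θ : ℝ}

theorem IsPrincipalBases.norm_map_starProjection_ιMulti {p q : ℕ} {e : Fin p → X} {f : Fin q → X}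
    (h : IsPrincipalBases V W e f) :
    ‖map (W.starProjection : X →ₗ[𝕜] X) (ιMulti 𝕜 p e)‖ = ‖inner 𝕜 (ιMulti 𝕜 p e)
      (ιMulti 𝕜 (min p q) fun i => f (Fin.castLE (min_le_right p q) i))‖ := by
  rw [map_apply_ιMulti]
  rcases le_or_gt p q with hpq | hqp
  · let g : Fin p → X := fun i => f (Fin.castLE hpq i)
    have hg : Orthonormal 𝕜 g := h.orthonormal_right.comp _ (Fin.castLE_injective hpq)
    have hproj : ⇑(W.starProjection : X →ₗ[𝕜] X) ∘ e = fun i => inner 𝕜 (g i) (e i) • g i :=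
      funext fun i => h.starProjection_eq_smul i (i.isLt.trans_le hpq)
    have hpair : Pairwise fun i j => inner 𝕜 (e i) (g j) = 0 := fun i j hij =>
      h.inner_eq_zero i _ (Fin.val_ne_of_ne hij)
    have hmin : (ιMulti 𝕜 (min p q) fun i => f (Fin.castLE (min_le_right p q) i)) = ιMulti 𝕜 p g :=
      ιMulti_comp_cast (min_eq_left hpq) g
    rw [hproj, (ιMulti 𝕜 p).map_smul_univ, norm_smul, norm_ιMulti_of_orthonormal hg, mul_one, hmin,
      inner_ιMulti_of_pairwise_inner_eq_zero hpair, norm_prod, norm_prod]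
    exact Finset.prod_congr rfl fun i _ => norm_inner_symm _ _
  · rw [inner_ιMulti_of_ne (by omega), norm_zero, norm_eq_zero]
    exact (ιMulti 𝕜 p).map_coord_zero ⟨q, hqp⟩ (h.starProjection_eq_zero _ le_rfl)

theorem IsPrincipalBases.isAsymmetricAngle {p q : ℕ} {e : Fin p → X} {f : Fin q → X}
    (h : IsPrincipalBases V W e f) :
    IsAsymmetricAngle V W (Real.arccos ‖inner 𝕜 (ιMulti 𝕜 p e)
      (ιMulti 𝕜 (min p q) fun i => f (Fin.castLE (min_le_right p q) i))‖) := by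
  have he := norm_ιMulti_of_orthonormal h.orthonormal_left
  have hf := norm_ιMulti_of_orthonormal h.orthonormal_right
  have hV := (bladeSpace_ιMulti_of_orthonormal h.orthonormal_left).trans h.span_left
  have hW := (bladeSpace_ιMulti_of_orthonormal h.orthonormal_right).trans h.span_right
  refine ⟨ιMulti 𝕜 p e, ιMulti 𝕜 q f, _, _, isBlade_ιMulti e, norm_ne_zero_iff.mp (by simp [he]),
    hV, isBlade_ιMulti f, norm_ne_zero_iff.mp (by simp [hf]), hW,
    ⟨p, q, e, f, 1, hV.symm ▸ hW.symm ▸ h, norm_one, rfl, rfl, ?_⟩, ?_⟩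
  · rw [hf, RCLike.ofReal_one, mul_one, one_smul, ιMulti_mul_ιMulti,
      ← ιMulti_comp_cast (Nat.add_sub_cancel' (min_le_right p q)) f]
    congr 1
    ext i
    induction i using Fin.addCases with
    | left i => rw [Fin.append_left]; rfl
    | right i => rw [Fin.append_right]; rfl
  · rw [he, hf, RCLike.ofReal_one, mul_one, one_smul, mul_one, div_one]

theorem IsAsymmetricAngle.exists_isPrincipalBases (h : IsAsymmetricAngle V W Θ) :
    ∃ (p q : ℕ) (e : Fin p → X) (f : Fin q → X), IsPrincipalBases V W e f ∧
      Θ = Real.arccos ‖inner 𝕜 (ιMulti 𝕜 p e)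
        (ιMulti 𝕜 (min p q) fun i => f (Fin.castLE (min_le_right p q) i))‖ := by
  obtain ⟨C, D, _, _, hC, hC0, rfl, -, hD0, rfl, ⟨p, q, e, f, ε, hef, hε, rfl, -, -⟩, rfl⟩ := h
  obtain ⟨c, hc, hCe⟩ := hC.exists_eq_smul_ιMulti hef.orthonormal_left hef.span_left
  refine ⟨p, q, e, f, hef, congrArg Real.arccos ?_⟩
  have hC' : ‖C‖ ≠ 0 := norm_ne_zero_iff.mpr hC0
  have hD' : ‖D‖ ≠ 0 := norm_ne_zero_iff.mpr hD0
  rw [div_eq_iff (mul_ne_zero hC' hD'), ← hc, hCe, inner_smul_left, inner_smul_right, norm_mul,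
    norm_mul, norm_mul, RCLike.norm_conj, hε, RCLike.norm_ofReal, abs_norm]
  ring

theorem IsAsymmetricAngle.mem_Icc (h : IsAsymmetricAngle V W Θ) : Θ ∈ Set.Icc 0 Real.pi := by
  obtain ⟨p, q, e, f, -, rfl⟩ := h.exists_isPrincipalBases
  exact ⟨Real.arccos_nonneg _, Real.arccos_le_pi _⟩

theorem IsAsymmetricAngle.norm_map_starProjection (h : IsAsymmetricAngle (bladeSpace A) W Θ)
    (hA : IsBlade A) :
    ‖map (W.starProjection : X →ₗ[𝕜] X) A‖ = ‖A‖ * Real.cos Θ := by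
  obtain ⟨p, q, e, f, hef, rfl⟩ := h.exists_isPrincipalBases
  obtain ⟨a, ha, hAe⟩ := hA.exists_eq_smul_ιMulti hef.orthonormal_left hef.span_left
  rw [Real.cos_arccos (neg_one_lt_zero.le.trans (norm_nonneg _)) ?_,
    ← hef.norm_map_starProjection_ιMulti, ← ha, ← norm_smul, ← map_smul, ← hAe]
  calc ‖inner 𝕜 (ιMulti 𝕜 p e) (ιMulti 𝕜 (min p q) fun i => f (Fin.castLE _ i))‖
    _ ≤ ‖ιMulti 𝕜 p e‖ * ‖ιMulti 𝕜 (min p q) fun i => f (Fin.castLE _ i)‖ := norm_inner_le_norm _ _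
    _ = 1 * 1 := congrArg₂ _ (norm_ιMulti_of_orthonormal hef.orthonormal_left)
        (norm_ιMulti_of_orthonormal (hef.orthonormal_right.comp _ (Fin.castLE_injective _)))
    _ = 1 := one_mul 1

theorem existsUnique_isAsymmetricAngle (V W : Submodule 𝕜 X) :
    ∃! Θ : ℝ, IsAsymmetricAngle V W Θ := by
  obtain ⟨p, q, e, f, h⟩ := exists_isPrincipalBases V W
  have he := norm_ιMulti_of_orthonormal h.orthonormal_left
  have hcos {Θ : ℝ} (hΘ : IsAsymmetricAngle V W Θ) :
      ‖map (W.starProjection : X →ₗ[𝕜] X) (ιMulti 𝕜 p e)‖ = Real.cos Θ := by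
    rw [← h.span_left, ← bladeSpace_ιMulti_of_orthonormal h.orthonormal_left] at hΘ
    rw [hΘ.norm_map_starProjection (isBlade_ιMulti e), he, one_mul]
  exact ⟨_, h.isAsymmetricAngle, fun Θ hΘ => Real.injOn_cos hΘ.mem_Icc h.isAsymmetricAngle.mem_Icc
    ((hcos hΘ).symm.trans (hcos h.isAsymmetricAngle))⟩

theorem isAsymmetricAngle_asymmetricAngle (V W : Submodule 𝕜 X) :
    IsAsymmetricAngle V W (asymmetricAngle V W) := by
  have h := existsUnique_isAsymmetricAngle V W
  rw [asymmetricAngle, dif_pos h]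
  exact h.choose_spec.1

theorem IsBlade.norm_map_starProjection (hA : IsBlade A) (W : Submodule 𝕜 X) :
    ‖map (W.starProjection : X →ₗ[𝕜] X) A‖ = ‖A‖ * Real.cos (asymmetricAngle (bladeSpace A) W) :=
  (isAsymmetricAngle_asymmetricAngle _ _).norm_map_starProjection hA

theorem IsBlade.norm_map_starProjection_mul (hA : IsBlade A) (hB : IsBlade B) :
    ‖map ((bladeSpace B)ᗮ.starProjection : X →ₗ[𝕜] X) A * B‖ =
      ‖map ((bladeSpace B)ᗮ.starProjection : X →ₗ[𝕜] X) A‖ * ‖B‖ := by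
  obtain ⟨p, v, hv, hvA⟩ := exists_orthonormal_span_range_eq (bladeSpace A)
  obtain ⟨q, w, hw, hwB⟩ := exists_orthonormal_span_range_eq (bladeSpace B)
  obtain ⟨a, -, hAv⟩ := hA.exists_eq_smul_ιMulti hv hvA
  obtain ⟨b, -, hBw⟩ := hB.exists_eq_smul_ιMulti hw hwB
  obtain ⟨u, huw, hAu⟩ : ∃ u : Fin p → X, (∀ i j, inner 𝕜 (u i) (w j) = 0) ∧
      map ((bladeSpace B)ᗮ.starProjection : X →ₗ[𝕜] X) A = a • ιMulti 𝕜 p u :=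
    ⟨fun i => (bladeSpace B)ᗮ.starProjection (v i), fun i j =>
      Submodule.inner_left_of_mem_orthogonal (hwB ▸ Submodule.subset_span (Set.mem_range_self j))
        (Submodule.starProjection_apply_mem _ _), by rw [hAv, map_smul, map_apply_ιMulti]; rfl⟩
  rw [hAu, hBw, smul_mul_smul_comm, norm_smul, norm_smul, norm_smul, norm_mul,
    norm_ιMulti_mul_ιMulti huw, mul_mul_mul_comm]

protected theorem IsBlade.norm_mul (hA : IsBlade A) (hB : IsBlade B) :
    ‖A * B‖ = ‖A‖ * ‖B‖ * Real.cos (asymmetricAngle (bladeSpace A) (bladeSpace B)ᗮ) := by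
  rcases eq_or_ne B 0 with rfl | hB0
  · rw [mul_zero, norm_zero, mul_zero, zero_mul]
  have hproj (x : X) : ι 𝕜 ((bladeSpace B)ᗮ.starProjection x - x) * B = 0 := by
    rw [← hB.mem_bladeSpace_iff hB0, ← neg_sub, Submodule.neg_mem_iff]
    simpa only [Submodule.orthogonal_orthogonal] using
      (bladeSpace B)ᗮ.sub_starProjection_mem_orthogonal x
  rw [← map_mul_eq_mul (f := ((bladeSpace B)ᗮ.starProjection : X →ₗ[𝕜] X)) hproj,
    hA.norm_map_starProjection_mul hB, hA.norm_map_starProjection, mul_right_comm]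

end AsymmetricAngle

end Grassmann

theorem mainTheorem3 {𝕜 : Type*} [RCLike 𝕜] {X : Type*} [NormedAddCommGroup X]
    [InnerProductSpace 𝕜 X] [FiniteDimensional 𝕜 X]
    (Ω : ExteriorAlgebra 𝕜 X) (hΩ : Grassmann.IsOrientation Ω)
    (A B : ExteriorAlgebra 𝕜 X) (hA : Grassmann.IsBlade A) (hB : Grassmann.IsBlade B) :
    ‖Grassmann.regressive Ω A B‖ =
      ‖A‖ * ‖B‖ * Real.cos (Grassmann.asymmetricAngle
        (Grassmann.bladeSpace A)ᗮ (Grassmann.bladeSpace B)) := by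
  rw [Grassmann.norm_regressive hΩ hA hB, (hA.rightStar hΩ).norm_mul (hB.rightStar hΩ),
    hA.norm_rightStar hΩ, hB.norm_rightStar hΩ]
  rcases eq_or_ne A 0 with rfl | hA0
  · rw [norm_zero, zero_mul, zero_mul, zero_mul]
  rcases eq_or_ne B 0 with rfl | hB0
  · rw [norm_zero, mul_zero, zero_mul, zero_mul]
  rw [hA.bladeSpace_rightStar hΩ hA0, hB.bladeSpace_rightStar hΩ hB0,
    Submodule.orthogonal_orthogonal]
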